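/- Let $G=(V,E)$ be a finite, simple, undirected, triangle-free graph, let $d(v)$ denote the degree of a vertex $v\in V$, and let $a(G)$ denote the maximum size of a set $S\subseteq V$ such that the induced subgraph $G[S]$ is a forest (i.e. contains no cycle). Then \[ a(G)\;\ge\;\sum_{v\in V}\min\left(1,\frac{3}{d(v)+2}\right). \] -/

import Mathlib

namespace SimpleGraph

/-- A set `S` of vertices is acyclic if the induced subgraph `G[S]` is a forest. -/
def IsAcyclicSet {V : Type*} (G : SimpleGraph V) (S : Set V) : Prop :=
  (G.induce S).IsAcyclic

open Classical in
/-- `a(G)`: the maximum size of an acyclic set of a finite graph `G`.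
The empty set is acyclic, so the maximum is over a nonempty finite family. -/
noncomputable def acyclicNumber {V : Type*} [Fintype V] (G : SimpleGraph V) : ℕ :=
  ((Finset.univ : Finset (Finset V)).filter
    fun S : Finset V => G.IsAcyclicSet (S : Set V)).sup Finset.card

end SimpleGraph

namespace SimpleGraph

open Finset

section Acyclic

variable {V : Type*} {G : SimpleGraph V}

/-- Adding a vertex with at most one neighbour in an acyclic set keeps the set acyclic. -/
theorem IsAcyclicSet.insert {S : Set V} (h : G.IsAcyclicSet S) {v : V}
    (hv : ∀ x ∈ S, ∀ y ∈ S, G.Adj v x → G.Adj v y → x = y) :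
    G.IsAcyclicSet (insert v S) := by
  classical
  intro x p hp
  by_cases hvp : (⟨v, Set.mem_insert v S⟩ : ↥(Insert.insert v S)) ∈ p.support
  · set q := p.rotate _ hvp
    have hqc : q.IsCycle := hp.rotate hvp
    have h1 := q.adj_snd hqc.not_nil
    have h2 := (q.adj_penultimate hqc.not_nil).symm
    have mem : ∀ z : ↥(Insert.insert v S), G.Adj v z → (z : V) ∈ S := fun z hz =>
      (Set.mem_insert_iff.1 z.2).resolve_left fun e => hz.ne e.symm
    exact hqc.snd_ne_penultimate
      (Subtype.ext (hv _ (mem _ h1) _ (mem _ h2) h1 h2))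
  · let p' := p.map (Embedding.induce (G := G) (Insert.insert v S)).toHom
    have hp' : p'.IsCycle := hp.map Subtype.val_injective
    have hs : ∀ y ∈ p'.support, y ∈ S := by
      intro y hy
      simp only [p', Walk.support_map, List.mem_map] at hy
      obtain ⟨z, hz, rfl⟩ := hy
      refine (Set.mem_insert_iff.1 z.2).resolve_left fun e => hvp ?_
      convert hz
      exact e.symm
    refine h (p'.induce S hs) ?_
    have := Walk.map_induce p' hs
    rw [← this] at hp'
    exact (Walk.isCycle_map_iff_of_injective Subtype.val_injective).1 hp'

theorem isAcyclicSet_empty : G.IsAcyclicSet ∅ := IsAcyclic.of_subsingleton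

theorem IsAcyclicSet.singleton_union [DecidableEq V] {S W : Finset V} {v : V}
    (h : G.IsAcyclicSet (S : Set V)) (hS : S ⊆ W)
    (hv : ∀ x ∈ W, ∀ y ∈ W, G.Adj v x → G.Adj v y → x = y) :
    G.IsAcyclicSet (({v} ∪ S : Finset V) : Set V) := by
  rw [← insert_eq, coe_insert]
  exact h.insert fun x hx y hy => hv x (hS hx) y (hS hy)

end Acyclic

/-- The weight of a vertex of degree `m`. -/
noncomputable def forestWeight (m : ℕ) : ℝ := min 1 (3 / ((m : ℝ) + 2))

/-- The increase of `forestWeight` when the degree drops from `m ≥ 2` to `m - 1`. -/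
noncomputable def forestGain (m : ℕ) : ℝ := 3 / (((m : ℝ) + 1) * ((m : ℝ) + 2))

theorem forestWeight_eq {m : ℕ} (hm : 1 ≤ m) : forestWeight m = 3 / ((m : ℝ) + 2) := by
  have : (1 : ℝ) ≤ m := by exact_mod_cast hm
  exact min_eq_right ((div_le_one (by positivity)).2 (by linarith))

theorem forestWeight_eq_one {m : ℕ} (hm : m ≤ 1) : forestWeight m = 1 := by
  have : (m : ℝ) ≤ 1 := by exact_mod_cast hm
  exact min_eq_left ((one_le_div (by positivity)).2 (by linarith))

theorem forestWeight_antitone : Antitone forestWeight := by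
  intro a b hab
  have : (a : ℝ) ≤ b := by exact_mod_cast hab
  unfold forestWeight
  gcongr

theorem forestGain_pos (m : ℕ) : 0 < forestGain m := by unfold forestGain; positivity

theorem forestGain_antitone : Antitone forestGain := by
  intro a b hab
  have : (a : ℝ) ≤ b := by exact_mod_cast hab
  unfold forestGain
  gcongr

theorem forestWeight_eq_mul_forestGain {m : ℕ} (hm : 1 ≤ m) :
    forestWeight m = ((m : ℝ) + 1) * forestGain m := by
  rw [forestWeight_eq hm, forestGain]; field_simp

theorem forestGain_pred {d : ℕ} (hd : 1 ≤ d) :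
    forestGain (d - 1) = (1 + 2 / (d : ℝ)) * forestGain d := by
  have : (0 : ℝ) < d := by exact_mod_cast hd
  unfold forestGain
  push_cast [hd]
  rw [sub_add_cancel, show (d : ℝ) - 1 + 2 = d + 1 by ring]
  field_simp

theorem mul_forestGain_le_of_le_one {m k : ℕ} (hm : 2 ≤ m) (hk : k ≤ 1) :
    (k : ℝ) * forestGain m ≤ forestWeight (m - k) - forestWeight m := by
  obtain rfl | rfl : k = 0 ∨ k = 1 := by omega
  · simp
  · rw [forestWeight_eq (by omega : 1 ≤ m - 1), forestWeight_eq (by omega : 1 ≤ m), forestGain]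
    have : (0 : ℝ) < m := by exact_mod_cast (by omega : 0 < m)
    push_cast [(by omega : 1 ≤ m)]
    apply le_of_eq
    have h : (m : ℝ) - 1 + 2 ≠ 0 := by linarith
    field_simp
    ring

theorem mul_forestGain_le {m k : ℕ} (hm : 2 ≤ m) (hk : k ≤ m) :
    (k : ℝ) * forestGain (max m 4) ≤ forestWeight (m - k) - forestWeight m := by
  rcases lt_or_ge m 4 with h4 | h4
  · rw [max_eq_right h4.le]
    interval_cases m <;> interval_cases k <;> norm_num [forestWeight, forestGain]
  · rw [max_eq_left h4]
    have h4' : (4 : ℝ) ≤ m := by exact_mod_cast h4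
    have hk' : (k : ℝ) ≤ m := by exact_mod_cast hk
    have hk0 : (0 : ℝ) ≤ k := by positivity
    rw [forestWeight_eq (by omega : 1 ≤ m), forestGain]
    rcases hk.eq_or_lt with rfl | hlt
    · rw [Nat.sub_self, forestWeight_eq_one (by norm_num), ← mul_div_assoc,
        div_le_iff₀ (by positivity)]
      field_simp
      nlinarith
    · rw [forestWeight_eq (by omega : 1 ≤ m - k)]
      have hk1 : (k : ℝ) + 1 ≤ m := by exact_mod_cast hlt
      push_cast [hk]
      have h : (0 : ℝ) < (m : ℝ) - k + 2 := by linarith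
      rw [div_sub_div _ _ h.ne' (by positivity), ← mul_div_assoc,
        div_le_div_iff₀ (by positivity) (by positivity)]
      rcases Nat.eq_zero_or_pos k with rfl | hk0'
      · simp [mul_comm]
      have : (1 : ℝ) ≤ k := by exact_mod_cast hk0'
      have e : (3 * ((m : ℝ) + 2) - ((m : ℝ) - k + 2) * 3) * ((m + 1) * (m + 2)) -
        k * 3 * (((m : ℝ) - k + 2) * (m + 2)) = 3 * k * (m + 2) * (k - 1) := by ring
      have : 0 ≤ 3 * (k : ℝ) * (m + 2) * (k - 1) := by
        have : (0 : ℝ) ≤ k - 1 := by linarith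
        positivity
      linarith

theorem mul_le_forestWeight_three {k : ℕ} (hk : k ≤ 2) :
    (k : ℝ) * (3 / 20) ≤ forestWeight (3 - k) - forestWeight 3 := by
  interval_cases k <;> norm_num [forestWeight]

variable {V : Type*} {G : SimpleGraph V} [DecidableRel G.Adj]

/-- The neighbours of `v` in `U`. -/
def nbrIn (G : SimpleGraph V) [DecidableRel G.Adj] (U : Finset V) (v : V) : Finset V :=
  {w ∈ U | G.Adj v w}

theorem mem_nbrIn {U : Finset V} {v w : V} : w ∈ G.nbrIn U v ↔ w ∈ U ∧ G.Adj v w := by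
  simp [nbrIn]

theorem nbrIn_mono {R U : Finset V} (h : R ⊆ U) (v : V) : G.nbrIn R v ⊆ G.nbrIn U v :=
  filter_subset_filter _ h

theorem card_nbrIn_sdiff [DecidableEq V] {R U : Finset V} (h : R ⊆ U) (v : V) :
    #(G.nbrIn (U \ R) v) = #(G.nbrIn U v) - #(G.nbrIn R v) := by
  rw [← card_sdiff_of_subset (nbrIn_mono h v)]
  congr 1
  ext w
  simp only [mem_nbrIn, mem_sdiff]
  tauto

/-- The degree-weighted bound for the subgraph induced by `U`. -/
def ForestBound (G : SimpleGraph V) [DecidableRel G.Adj] (U : Finset V) : Prop :=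
  ∃ S ⊆ U, G.IsAcyclicSet (S : Set V) ∧ ∑ v ∈ U, forestWeight #(G.nbrIn U v) ≤ #S

/-- A vertex set violating `ForestBound` all of whose proper subsets satisfy it. -/
structure IsMinimalViolation (G : SimpleGraph V) [DecidableRel G.Adj] (U : Finset V) : Prop where
  not_forestBound : ¬ G.ForestBound U
  forestBound_of_ssubset : ∀ U', U' ⊂ U → G.ForestBound U'

namespace IsMinimalViolation

variable {U : Finset V}

theorem nonempty (hU : G.IsMinimalViolation U) : U.Nonempty := by
  rw [nonempty_iff_ne_empty]
  rintro rfl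
  exact hU.not_forestBound ⟨∅, subset_rfl, by simpa using isAcyclicSet_empty, by simp⟩

variable [DecidableEq V]

/-- If `T ⊆ R` can be added to every acyclic subset of `U \ R`, then removing `R` must lose weight.
Here `c w` bounds the weight gained by `w` per neighbour in `R`. -/
theorem card_add_sum_lt (hU : G.IsMinimalViolation U) {R T : Finset V} (hR : R ⊆ U)
    (hne : R.Nonempty) (hTR : T ⊆ R)
    (hT : ∀ S ⊆ U \ R, G.IsAcyclicSet (S : Set V) → G.IsAcyclicSet ((T ∪ S : Finset V) : Set V))
    (c : V → ℝ)
    (hc : ∀ w ∈ U \ R, #(G.nbrIn R w) * c w ≤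
      forestWeight (#(G.nbrIn U w) - #(G.nbrIn R w)) - forestWeight #(G.nbrIn U w)) :
    #T + ∑ x ∈ R, ∑ w ∈ G.nbrIn (U \ R) x, c w < ∑ x ∈ R, forestWeight #(G.nbrIn U x) := by
  obtain ⟨S, hSU, hS, hle⟩ := hU.forestBound_of_ssubset (U \ R) (sdiff_ssubset hR hne)
  by_contra! hcon
  refine hU.not_forestBound ⟨T ∪ S, union_subset (hTR.trans hR) (hSU.trans sdiff_subset),
    hT S hSU hS, ?_⟩
  have hdisj : Disjoint T S :=
    Finset.disjoint_left.2 fun x hx hx' => (mem_sdiff.1 (hSU hx')).2 (hTR hx)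
  rw [card_union_of_disjoint hdisj, ← sum_sdiff hR]
  have hswap : ∑ x ∈ R, ∑ w ∈ G.nbrIn (U \ R) x, c w = ∑ w ∈ U \ R, #(G.nbrIn R w) * c w := by
    simp_rw [← nsmul_eq_mul, ← sum_const]
    refine sum_comm' fun x w => ?_
    simp only [mem_nbrIn, G.adj_comm x w]
    tauto
  have hsum := sum_le_sum hc
  rw [sum_sub_distrib] at hsum
  simp_rw [card_nbrIn_sdiff hR] at hle
  push_cast
  linarith

theorem two_le_card_nbrIn (hU : G.IsMinimalViolation U) {v : V} (hv : v ∈ U) :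
    2 ≤ #(G.nbrIn U v) := by
  by_contra! hlt
  have hle : #(G.nbrIn U v) ≤ 1 := by omega
  have := hU.card_add_sum_lt (R := {v}) (T := {v}) (by simpa using hv) (by simp) subset_rfl
    (fun S hS h => h.singleton_union hS fun x hx y hy hvx hvy =>
      card_le_one.1 hle x (mem_nbrIn.2 ⟨(mem_sdiff.1 hx).1, hvx⟩) y
        (mem_nbrIn.2 ⟨(mem_sdiff.1 hy).1, hvy⟩))
    (fun _ => 0) (fun w _ => by
      simpa using forestWeight_antitone (Nat.sub_le _ _))
  simp [forestWeight_eq_one hle] at this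

theorem sum_forestGain_lt (hU : G.IsMinimalViolation U) {v : V} (hv : v ∈ U) :
    ∑ u ∈ G.nbrIn U v, forestGain #(G.nbrIn U u) < forestWeight #(G.nbrIn U v) := by
  have := hU.card_add_sum_lt (R := {v}) (T := ∅) (by simpa using hv) (by simp) (by simp)
    (fun S _ h => by simpa using h) (fun w => forestGain #(G.nbrIn U w))
    (fun w hw => mul_forestGain_le_of_le_one (hU.two_le_card_nbrIn (mem_sdiff.1 hw).1)
      ((card_le_card (filter_subset _ _)).trans (by simp)))
  have hN : G.nbrIn (U \ {v}) v = G.nbrIn U v := by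
    ext w
    simp only [mem_nbrIn, mem_sdiff, mem_singleton]
    exact ⟨fun h => ⟨h.1.1, h.2⟩, fun h => ⟨⟨h.1, h.2.ne'⟩, h.2⟩⟩
  simpa [hN] using this

/-- The inequality obtained by keeping `v` and deleting all its neighbours but `u₀`. -/
theorem lt_sum_nbrIn_erase (hU : G.IsMinimalViolation U)
    (htri : ∀ a b c, G.Adj a b → G.Adj a c → ¬ G.Adj b c) {v u₀ : V} (hv : v ∈ U)
    (hu₀ : u₀ ∈ G.nbrIn U v) (hd : 4 ≤ #(G.nbrIn U v))
    (hmax : ∀ w ∈ U, #(G.nbrIn U w) ≤ #(G.nbrIn U v)) :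
    1 + forestGain #(G.nbrIn U v) - forestWeight #(G.nbrIn U v) <
      ∑ u ∈ (G.nbrIn U v).erase u₀, (forestWeight #(G.nbrIn U u) -
        ∑ w ∈ G.nbrIn U u, forestGain (max #(G.nbrIn U w) 4) + forestGain #(G.nbrIn U v)) := by
  set N := G.nbrIn U v with hN
  have hNU : N ⊆ U := filter_subset _ _
  have hadj : ∀ u ∈ N, G.Adj v u := fun u hu => (mem_nbrIn.1 hu).2
  have hvN : v ∉ N.erase u₀ := fun h => G.loopless.irrefl v (hadj v (mem_of_mem_erase h))
  set R := insert v (N.erase u₀) with hR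
  have hRU : R ⊆ U := insert_subset hv ((erase_subset _ _).trans hNU)
  have hout : ∀ x ∈ U \ R, G.Adj v x → x = u₀ := by
    intro x hx hvx
    by_contra hne
    exact (mem_sdiff.1 hx).2 (mem_insert_of_mem
      (mem_erase.2 ⟨hne, mem_nbrIn.2 ⟨(mem_sdiff.1 hx).1, hvx⟩⟩))
  have key := hU.card_add_sum_lt (R := R) (T := {v}) hRU (by simp [hR])
    (by simp [hR])
    (fun S hS h => h.singleton_union hS fun x hx y hy hvx hvy =>
      (hout x hx hvx).trans (hout y hy hvy).symm)
    (fun w => forestGain (max #(G.nbrIn U w) 4))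
    (fun w hw => mul_forestGain_le (hU.two_le_card_nbrIn (mem_sdiff.1 hw).1)
      (card_le_card (nbrIn_mono hRU w)))
  rw [sum_insert hvN, sum_insert hvN] at key
  have h₀ : forestGain #N ≤ ∑ w ∈ G.nbrIn (U \ R) v, forestGain (max #(G.nbrIn U w) 4) := by
    refine (forestGain_antitone (max_le (hmax u₀ (hNU hu₀)) hd)).trans
      (single_le_sum (f := fun w => forestGain (max #(G.nbrIn U w) 4))
        (fun w _ => (forestGain_pos _).le) (mem_nbrIn.2 ⟨mem_sdiff.2 ⟨hNU hu₀, ?_⟩, hadj _ hu₀⟩))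
    simp [hR, (hadj _ hu₀).ne']
  have h₁ : ∑ u ∈ N.erase u₀, ∑ w ∈ G.nbrIn (U \ R) u, forestGain (max #(G.nbrIn U w) 4) =
      ∑ u ∈ N.erase u₀,
        (∑ w ∈ G.nbrIn U u, forestGain (max #(G.nbrIn U w) 4) - forestGain #N) := by
    refine sum_congr rfl fun u hu => ?_
    have hvu := hadj u (mem_of_mem_erase hu)
    have : G.nbrIn (U \ R) u = (G.nbrIn U u).erase v := by
      ext w
      simp only [mem_nbrIn, mem_sdiff, mem_erase, hR, mem_insert, not_or]
      constructor
      · rintro ⟨⟨h1, h2, -⟩, h3⟩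
        exact ⟨h2, h1, h3⟩
      · rintro ⟨h2, h1, h3⟩
        exact ⟨⟨h1, h2, fun h => htri v u w hvu (hadj w h.2) h3⟩, h3⟩
    rw [this, sum_erase_eq_sub (mem_nbrIn.2 ⟨hv, hvu.symm⟩), ← hN, max_eq_left hd]
  rw [h₁] at key
  simp only [card_singleton, Nat.cast_one] at key
  simp only [sum_add_distrib, sum_sub_distrib] at key ⊢
  linarith

theorem two_le_card_lower_nbrs (hU : G.IsMinimalViolation U)
    (htri : ∀ a b c, G.Adj a b → G.Adj a c → ¬ G.Adj b c) {v : V} (hv : v ∈ U)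
    (hd : 4 ≤ #(G.nbrIn U v)) (hmax : ∀ w ∈ U, #(G.nbrIn U w) ≤ #(G.nbrIn U v)) :
    2 ≤ #{u ∈ G.nbrIn U v | #(G.nbrIn U u) < #(G.nbrIn U v)} := by
  by_contra! hlt
  set N := G.nbrIn U v with hN
  set d := #N with hdN
  have hNU : N ⊆ U := filter_subset _ _
  obtain ⟨u₀, hu₀, hu₀'⟩ : ∃ u₀ ∈ N, ∀ u ∈ N.erase u₀, #(G.nbrIn U u) = d := by
    rcases Finset.eq_empty_or_nonempty {u ∈ N | #(G.nbrIn U u) < d} with he | ⟨u₀, hu₀⟩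
    · obtain ⟨u₀, hu₀⟩ : N.Nonempty := card_pos.1 (by omega)
      refine ⟨u₀, hu₀, fun u hu => (hmax u (hNU (mem_of_mem_erase hu))).antisymm ?_⟩
      by_contra! h
      exact (filter_eq_empty_iff.1 he) (mem_of_mem_erase hu) h
    · refine ⟨u₀, (mem_filter.1 hu₀).1, fun u hu =>
        (hmax u (hNU (mem_of_mem_erase hu))).antisymm ?_⟩
      by_contra! h
      exact (mem_erase.1 hu).1 (card_le_one.1 (by omega) u
        (mem_filter.2 ⟨mem_of_mem_erase hu, h⟩) u₀ hu₀)
  have key := hU.lt_sum_nbrIn_erase htri hv hu₀ hd hmax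
  rw [← hN, ← hdN] at key
  have hbound : ∀ u ∈ N.erase u₀, forestWeight #(G.nbrIn U u) -
      ∑ w ∈ G.nbrIn U u, forestGain (max #(G.nbrIn U w) 4) + forestGain d ≤ 2 * forestGain d := by
    intro u hu
    have h1 : #(G.nbrIn U u) • forestGain d ≤
        ∑ w ∈ G.nbrIn U u, forestGain (max #(G.nbrIn U w) 4) :=
      card_nsmul_le_sum _ _ _ fun w hw =>
        forestGain_antitone (max_le (hmax w (mem_nbrIn.1 hw).1) hd)
    rw [hu₀' u hu, nsmul_eq_mul] at h1
    rw [hu₀' u hu, forestWeight_eq_mul_forestGain (by omega)]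
    linarith
  have h2 := sum_le_card_nsmul _ _ _ hbound
  rw [card_erase_of_mem hu₀, ← hdN, nsmul_eq_mul, Nat.cast_pred (by omega)] at h2
  have h4 : (4 : ℝ) ≤ d := by exact_mod_cast hd
  rw [forestWeight_eq_mul_forestGain (by omega)] at key
  have h5 : 1 + forestGain d - (d + 1) * forestGain d < (d - 1) * (2 * forestGain d) := by linarith
  have h6 : 1 = (d + 1) * (d + 2) / 3 * forestGain d := by unfold forestGain; field_simp
  nlinarith [forestGain_pos d, mul_nonneg (forestGain_pos d).le
    (mul_nonneg (by linarith : (0 : ℝ) ≤ d - 2) (by linarith : (0 : ℝ) ≤ d - 4))]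

theorem card_nbrIn_le_three (hU : G.IsMinimalViolation U)
    (htri : ∀ a b c, G.Adj a b → G.Adj a c → ¬ G.Adj b c) {x : V} (hx : x ∈ U) :
    #(G.nbrIn U x) ≤ 3 := by
  obtain ⟨v, hv, hmax⟩ := exists_max_image U (fun w => #(G.nbrIn U w)) ⟨x, hx⟩
  refine (hmax x hx).trans ?_
  by_contra! hd
  have hd : 4 ≤ #(G.nbrIn U v) := hd
  have hlow := hU.two_le_card_lower_nbrs htri hv hd hmax
  have hdel := hU.sum_forestGain_lt hv
  set N := G.nbrIn U v with hN
  set d := #N with hdN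
  have hNU : N ⊆ U := filter_subset _ _
  have hφ := forestGain_pos d
  have hd4 : (4 : ℝ) ≤ d := by exact_mod_cast hd
  have hpred : forestGain (d - 1) - forestGain d = 2 / d * forestGain d := by
    rw [forestGain_pred (by omega)]; ring
  have hstep : ∀ m < d, 2 / d * forestGain d ≤ forestGain m - forestGain d := by
    intro m hm
    have := forestGain_antitone (by omega : m ≤ d - 1)
    linarith
  have hexc : ∑ u ∈ N, (forestGain #(G.nbrIn U u) - forestGain d) < forestGain d := by
    rw [sum_sub_distrib, sum_const, nsmul_eq_mul, ← hdN]
    rw [forestWeight_eq_mul_forestGain (by omega)] at hdel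
    linarith
  have hexc0 : ∀ u ∈ N, 0 ≤ forestGain #(G.nbrIn U u) - forestGain d := fun u hu =>
    sub_nonneg.2 (forestGain_antitone (hmax u (hNU hu)))
  have hd5 : 5 ≤ d := by
    have h1 := card_nsmul_le_sum {u ∈ N | #(G.nbrIn U u) < d}
      (fun u => forestGain #(G.nbrIn U u) - forestGain d) (2 / d * forestGain d)
      fun u hu => hstep _ (mem_filter.1 hu).2
    have h2 := sum_le_sum_of_subset_of_nonneg (filter_subset (fun u => #(G.nbrIn U u) < d) N)
      fun u hu _ => hexc0 u hu
    have h3 : (2 : ℝ) ≤ #{u ∈ N | #(G.nbrIn U u) < d} := by exact_mod_cast hlow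
    rw [nsmul_eq_mul] at h1
    have h4 : 2 * (2 / d * forestGain d) < forestGain d := by
      have := mul_le_mul_of_nonneg_right h3 (by positivity : 0 ≤ 2 / (d : ℝ) * forestGain d)
      linarith
    have h5 : (4 : ℝ) < d := by
      rw [← mul_assoc, mul_lt_iff_lt_one_left hφ, ← mul_div_assoc, div_lt_one (by linarith)] at h4
      linarith
    exact_mod_cast h5
  obtain ⟨u₀, hu₀⟩ : ({u ∈ N | #(G.nbrIn U u) < d} : Finset V).Nonempty := card_pos.1 (by omega)
  obtain ⟨hu₀N, hu₀d⟩ := mem_filter.1 hu₀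
  have key := hU.lt_sum_nbrIn_erase htri hv hu₀N hd hmax
  rw [← hN, ← hdN] at key
  have hbound : ∀ u ∈ N.erase u₀, forestWeight #(G.nbrIn U u) -
      ∑ w ∈ G.nbrIn U u, forestGain (max #(G.nbrIn U w) 4) + forestGain d ≤
      (2 - 4 / d) * forestGain d + (d + 2) * (forestGain #(G.nbrIn U u) - forestGain d) := by
    intro u hu
    have huU := hNU (mem_of_mem_erase hu)
    have hu2 := hU.two_le_card_nbrIn huU
    rw [forestWeight_eq_mul_forestGain (by omega)]
    rcases (hmax u huU).lt_or_eq with hlt | heq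
    · have h1 : #(G.nbrIn U u) • forestGain d ≤
          ∑ w ∈ G.nbrIn U u, forestGain (max #(G.nbrIn U w) 4) :=
        card_nsmul_le_sum _ _ _ fun w hw =>
          forestGain_antitone (max_le (hmax w (mem_nbrIn.1 hw).1) hd)
      rw [nsmul_eq_mul] at h1
      have h2 := hstep _ hlt
      have h3 : (#(G.nbrIn U u) : ℝ) + 1 ≤ d := by exact_mod_cast hlt
      have h4 := mul_le_mul_of_nonneg_right h3 (hexc0 u (mem_of_mem_erase hu))
      have h5 : (2 - 4 / (d : ℝ)) * forestGain d =
        2 * forestGain d - 2 * (2 / d * forestGain d) := by ring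
      rw [h5]
      linarith
    · have hmax' : ∀ w ∈ U, #(G.nbrIn U w) ≤ #(G.nbrIn U u) := fun w hw =>
        (hmax w hw).trans heq.ge
      have hlow' := hU.two_le_card_lower_nbrs htri huU (heq ▸ hd) hmax'
      rw [show #(G.nbrIn U u) = d from heq] at hlow' ⊢
      have h1 := card_nsmul_le_sum {w ∈ G.nbrIn U u | #(G.nbrIn U w) < d}
        (fun w => forestGain (max #(G.nbrIn U w) 4) - forestGain d) (2 / d * forestGain d)
        fun w hw => hstep _ (max_lt (mem_filter.1 hw).2 (by omega))
      have h2 := sum_le_sum_of_subset_of_nonneg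
        (f := fun w => forestGain (max #(G.nbrIn U w) 4) - forestGain d)
        (filter_subset (fun w => #(G.nbrIn U w) < d) (G.nbrIn U u))
        fun w hw _ => sub_nonneg.2 (forestGain_antitone (max_le (hmax w (mem_nbrIn.1 hw).1) hd))
      have h3 : (2 : ℝ) ≤ #{w ∈ G.nbrIn U u | #(G.nbrIn U w) < d} := by exact_mod_cast hlow'
      have h4 := mul_le_mul_of_nonneg_right h3 (by positivity : 0 ≤ 2 / (d : ℝ) * forestGain d)
      rw [nsmul_eq_mul] at h1
      have h6 : ∑ w ∈ G.nbrIn U u, (forestGain (max #(G.nbrIn U w) 4) - forestGain d) =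
          ∑ w ∈ G.nbrIn U u, forestGain (max #(G.nbrIn U w) 4) - d * forestGain d := by
        rw [sum_sub_distrib, sum_const, nsmul_eq_mul, show #(G.nbrIn U u) = d from heq]
      have h5 : (2 - 4 / (d : ℝ)) * forestGain d =
        2 * forestGain d - 2 * (2 / d * forestGain d) := by ring
      rw [h5]
      linarith
  have h1 := key.trans_le (sum_le_sum hbound)
  rw [sum_add_distrib, sum_const, card_erase_of_mem hu₀N, ← hdN, nsmul_eq_mul,
    Nat.cast_pred (by omega), ← mul_sum, sum_erase_eq_sub hu₀N] at h1
  have h2 := hstep _ hu₀d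
  have h3 : ∑ u ∈ N, (forestGain #(G.nbrIn U u) - forestGain d) -
      (forestGain #(G.nbrIn U u₀) - forestGain d) ≤ (1 - 2 / d) * forestGain d := by linarith
  have h4 := mul_le_mul_of_nonneg_left h3 (by positivity : (0 : ℝ) ≤ d + 2)
  have h5 : (d - 1) * ((2 - 4 / d) * forestGain d) + (d + 2) * ((1 - 2 / d) * forestGain d) =
      (3 * d - 6) * forestGain d := by
    field_simp; ring
  rw [forestWeight_eq_mul_forestGain (by omega)] at h1
  have h6 : 1 = (d + 1) * (d + 2) / 3 * forestGain d := by unfold forestGain; field_simp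
  have hd5' : (5 : ℝ) ≤ d := by exact_mod_cast hd5
  have h7 : 1 + forestGain d - (d + 1) * forestGain d < (3 * d - 6) * forestGain d := by linarith
  nlinarith [mul_nonneg hφ.le
    (mul_nonneg (by linarith : (0 : ℝ) ≤ d - 4) (by linarith : (0 : ℝ) ≤ d - 5))]

/-- `card_add_sum_lt` with a uniform lower bound `c` on the gain per removed edge. -/
theorem card_add_mul_lt (hU : G.IsMinimalViolation U) {R T : Finset V} (hR : R ⊆ U)
    (hne : R.Nonempty) (hTR : T ⊆ R)
    (hT : ∀ S ⊆ U \ R, G.IsAcyclicSet (S : Set V) → G.IsAcyclicSet ((T ∪ S : Finset V) : Set V))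
    (c : ℝ)
    (hc : ∀ w ∈ U \ R, #(G.nbrIn R w) * c ≤
      forestWeight (#(G.nbrIn U w) - #(G.nbrIn R w)) - forestWeight #(G.nbrIn U w)) :
    #T + ((∑ x ∈ R, (#(G.nbrIn U x) - #(G.nbrIn R x)) : ℕ) : ℝ) * c <
      ∑ x ∈ R, forestWeight #(G.nbrIn U x) := by
  have := hU.card_add_sum_lt hR hne hTR hT (fun _ => c) hc
  simp only [sum_const, nsmul_eq_mul, card_nbrIn_sdiff hR, ← sum_mul] at this
  exact_mod_cast this

theorem isAcyclicSet_pair_union {W S : Finset V} {p q : V} (hS : S ⊆ W)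
    (h : G.IsAcyclicSet (S : Set V)) (hq : #(G.nbrIn W q) ≤ 1)
    (hp : #(G.nbrIn (insert q W) p) ≤ 1) :
    G.IsAcyclicSet (({p, q} ∪ S : Finset V) : Set V) := by
  have h1 : G.IsAcyclicSet (({q} ∪ S : Finset V) : Set V) :=
    h.singleton_union hS fun x hx y hy hqx hqy =>
      card_le_one.1 hq x (mem_nbrIn.2 ⟨hx, hqx⟩) y (mem_nbrIn.2 ⟨hy, hqy⟩)
  have h2 := h1.singleton_union (W := insert q W) (v := p)
    (by rw [← insert_eq]; exact insert_subset_insert q hS) fun x hx y hy hpx hpy =>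
      card_le_one.1 hp x (mem_nbrIn.2 ⟨hx, hpx⟩) y (mem_nbrIn.2 ⟨hy, hpy⟩)
  rwa [← union_assoc, ← insert_eq] at h2

/-- The inequality obtained by keeping a vertex `v` of degree two and deleting its neighbour `u`. -/
theorem one_add_mul_lt (hU : G.IsMinimalViolation U)
    (htri : ∀ a b c, G.Adj a b → G.Adj a c → ¬ G.Adj b c) {u v : V} (hu : u ∈ U) (hv : v ∈ U)
    (huv : G.Adj u v) (hv2 : #(G.nbrIn U v) = 2) {c : ℝ}
    (hc : ∀ w ∈ U, G.Adj u w ∨ G.Adj v w → c ≤ forestGain #(G.nbrIn U w)) :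
    1 + #(G.nbrIn U u) * c < forestWeight #(G.nbrIn U u) + 3 / 4 := by
  have hR : ({u, v} : Finset V) ⊆ U := insert_subset hu (singleton_subset_iff.2 hv)
  have hRu : G.nbrIn {u, v} u = {v} := by simp [nbrIn, filter_insert, filter_singleton, huv]
  have hRv : G.nbrIn {u, v} v = {u} := by simp [nbrIn, filter_insert, filter_singleton, huv.symm]
  have hle : ∀ w, #(G.nbrIn {u, v} w) ≤ 1 := by
    intro w
    by_cases h : G.Adj w u
    · have h' : ¬ G.Adj w v := fun h' => htri w u v h h' huv
      simp [nbrIn, filter_insert, filter_singleton, h, h']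
    · simp only [nbrIn, filter_insert, filter_singleton, h, if_false]
      split_ifs <;> simp
  have hW : #(G.nbrIn (U \ {u, v}) v) ≤ 1 := by
    rw [card_nbrIn_sdiff hR, hRv, hv2]; simp
  have key := hU.card_add_mul_lt (R := {u, v}) (T := {v}) hR (by simp) (by simp)
    (fun S hS h => h.singleton_union hS fun x hx y hy hvx hvy =>
      card_le_one.1 hW x (mem_nbrIn.2 ⟨hx, hvx⟩) y (mem_nbrIn.2 ⟨hy, hvy⟩)) c (fun w hw => by
      have hwU := (mem_sdiff.1 hw).1
      refine le_trans ?_ (mul_forestGain_le_of_le_one (hU.two_le_card_nbrIn hwU) (hle w))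
      rcases Finset.eq_empty_or_nonempty (G.nbrIn {u, v} w) with h | ⟨x, hx⟩
      · simp [h]
      · gcongr
        refine hc w hwU ?_
        simp only [mem_nbrIn, mem_insert, mem_singleton] at hx
        obtain ⟨rfl | rfl, h⟩ := hx
        · exact Or.inl h.symm
        · exact Or.inr h.symm)
  rw [sum_pair huv.ne, sum_pair huv.ne, hRu, hRv, hv2] at key
  have h1 := hU.two_le_card_nbrIn hu
  have h2 : forestWeight 2 = 3 / 4 := by norm_num [forestWeight]
  have h3 : #(G.nbrIn U u) - #{v} + (2 - #{u}) = #(G.nbrIn U u) := by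
    simp only [card_singleton]; omega
  rw [h2, h3, card_singleton, Nat.cast_one] at key
  exact key

theorem card_nbrIn_eq_three (hU : G.IsMinimalViolation U)
    (htri : ∀ a b c, G.Adj a b → G.Adj a c → ¬ G.Adj b c) {v : V} (hv : v ∈ U) :
    #(G.nbrIn U v) = 3 := by
  have h23 : ∀ w ∈ U, #(G.nbrIn U w) = 2 ∨ #(G.nbrIn U w) = 3 := fun w hw => by
    have := hU.two_le_card_nbrIn hw
    have := hU.card_nbrIn_le_three htri hw
    omega
  have hnbr : ∀ x ∈ U, #(G.nbrIn U x) = 2 → ∀ y ∈ U, G.Adj y x → #(G.nbrIn U y) = 2 := by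
    intro x hx hx2 y hy hyx
    refine (h23 y hy).resolve_right fun hy3 => ?_
    have := hU.one_add_mul_lt htri hy hx hyx hx2 (c := forestGain 3)
      fun w hw _ => forestGain_antitone (hU.card_nbrIn_le_three htri hw)
    rw [hy3] at this
    norm_num [forestGain, forestWeight] at this
  refine (h23 v hv).resolve_left fun hv2 => ?_
  obtain ⟨u, hu⟩ : (G.nbrIn U v).Nonempty := card_pos.1 (by omega)
  obtain ⟨huU, hvu⟩ := mem_nbrIn.1 hu
  have hu2 := hnbr v hv hv2 u huU hvu.symm
  have := hU.one_add_mul_lt htri huU hv hvu.symm hv2 (c := forestGain 2) fun w hw h => by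
    rcases h with h | h
    · rw [hnbr u huU hu2 w hw h.symm]
    · rw [hnbr v hv hv2 w hw h.symm]
  rw [hu2] at this
  norm_num [forestGain, forestWeight] at this

theorem no_four_cycle (hU : G.IsMinimalViolation U)
    (htri : ∀ a b c, G.Adj a b → G.Adj a c → ¬ G.Adj b c) {a b c e : V} (ha : a ∈ U) (hb : b ∈ U)
    (hc : c ∈ U) (he : e ∈ U) (hab : G.Adj a b) (hbc : G.Adj b c) (hce : G.Adj c e)
    (hea : G.Adj e a) (hac : a ≠ c) (hbe : b ≠ e) : False := by
  have h3 : ∀ w ∈ U, #(G.nbrIn U w) = 3 := fun w hw => hU.card_nbrIn_eq_three htri hw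
  have nac : ¬ G.Adj a c := htri b a c hab.symm hbc
  have nbe : ¬ G.Adj b e := htri a b e hab hea.symm
  have nca : ¬ G.Adj c a := fun h => nac h.symm
  have neb : ¬ G.Adj e b := fun h => nbe h.symm
  set R : Finset V := {a, b, c, e} with hRdef
  have hR : R ⊆ U := by
    simp [hRdef, insert_subset_iff, ha, hb, hc, he]
  have hdeg : ∀ x ∈ R, #(G.nbrIn R x) = 2 := by
    simp only [hRdef, mem_insert, mem_singleton]
    rintro x (rfl | rfl | rfl | rfl) <;>
      simp [nbrIn, filter_insert, filter_singleton, hab, hab.symm, hbc, hbc.symm, hce, hce.symm,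
        hea, hea.symm, nac, nbe, nca, neb, hac, hbe]
  have hcard : #R = 4 := by
    simp [hRdef, hab.ne, hac, hea.ne', hbc.ne, hbe, hce.ne]
  have hout : ∀ x ∈ R, #(G.nbrIn (U \ R) x) = 1 := fun x hx => by
    rw [card_nbrIn_sdiff hR, hdeg x hx, h3 x (hR hx)]
  have key := hU.card_add_mul_lt (R := R) (T := {b, e}) hR (by simp [hRdef])
    (by simp [hRdef, insert_subset_iff])
    (fun S hS h => isAcyclicSet_pair_union hS h (hout e (by simp [hRdef])).le (by
      rw [nbrIn, filter_insert, if_neg nbe]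
      exact (hout b (by simp [hRdef])).le))
    (1 / 10) (fun w hw => by
      have hwU := (mem_sdiff.1 hw).1
      have := mul_forestGain_le (hU.two_le_card_nbrIn hwU) (card_le_card (nbrIn_mono hR w))
      refine le_trans (le_of_eq ?_) this
      rw [h3 w hwU]
      norm_num [forestGain])
  have hs : ∑ x ∈ R, (#(G.nbrIn U x) - #(G.nbrIn R x)) = 4 := by
    rw [sum_congr rfl fun x hx => by rw [hdeg x hx, h3 x (hR hx)]]
    simp [hcard]
  have hf : ∑ x ∈ R, forestWeight #(G.nbrIn U x) = 12 / 5 := by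
    rw [sum_congr rfl fun x hx => by rw [h3 x (hR hx)], sum_const, hcard]
    norm_num [forestWeight]
  rw [hs, hf, card_pair hbe] at key
  norm_num at key

theorem false (hU : G.IsMinimalViolation U)
    (htri : ∀ a b c, G.Adj a b → G.Adj a c → ¬ G.Adj b c) : False := by
  have h3 : ∀ w ∈ U, #(G.nbrIn U w) = 3 := fun w hw => hU.card_nbrIn_eq_three htri hw
  obtain ⟨u, hu⟩ := hU.nonempty
  obtain ⟨v, a, b, hva, hvb, hab, hNu⟩ := card_eq_three.1 (h3 u hu)
  have hmemu : ∀ x, x ∈ U ∧ G.Adj u x ↔ x = v ∨ x = a ∨ x = b := fun x => by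
    rw [← mem_nbrIn, hNu]; simp
  obtain ⟨hv, huv⟩ := (hmemu v).2 (by simp)
  obtain ⟨ha, hua⟩ := (hmemu a).2 (by simp)
  obtain ⟨hb, hub⟩ := (hmemu b).2 (by simp)
  obtain ⟨c, hcN⟩ : ((G.nbrIn U v).erase u).Nonempty := card_pos.1 (by
    rw [card_erase_of_mem (mem_nbrIn.2 ⟨hu, huv.symm⟩), h3 v hv]; norm_num)
  obtain ⟨hcu, hcN⟩ := mem_erase.1 hcN
  obtain ⟨hc, hvc⟩ := mem_nbrIn.1 hcN
  have nva := htri u v a huv hua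
  have nvb := htri u v b huv hub
  have nab := htri u a b hua hub
  have nuc := htri v u c huv.symm hvc
  have nac : ¬ G.Adj a c := fun h =>
    hU.no_four_cycle htri hu ha hc hv hua h hvc.symm huv.symm hcu.symm hva.symm
  have nbc : ¬ G.Adj b c := fun h =>
    hU.no_four_cycle htri hu hb hc hv hub h hvc.symm huv.symm hcu.symm hvb.symm
  have nav : ¬ G.Adj a v := fun h => nva h.symm
  have nbv : ¬ G.Adj b v := fun h => nvb h.symm
  have nba : ¬ G.Adj b a := fun h => nab h.symm
  have ncu : ¬ G.Adj c u := fun h => nuc h.symm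
  have nca : ¬ G.Adj c a := fun h => nac h.symm
  have ncb : ¬ G.Adj c b := fun h => nbc h.symm
  have hac : a ≠ c := fun h => nuc (h ▸ hua)
  have hbc : b ≠ c := fun h => nuc (h ▸ hub)
  set R : Finset V := {u, v, a, b, c} with hRdef
  have hR : R ⊆ U := by
    simp [hRdef, insert_subset_iff, ha, hb, hc, hu, hv]
  have hRu : #(G.nbrIn R u) = 3 := by
    simp [hRdef, nbrIn, filter_insert, filter_singleton, huv, hua, hub, nuc, hva, hvb, hab]
  have hRv : #(G.nbrIn R v) = 2 := by
    simp [hRdef, nbrIn, filter_insert, filter_singleton, huv.symm, nva, nvb, hvc, hcu.symm]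
  have hRa : #(G.nbrIn R a) = 1 := by
    simp [hRdef, nbrIn, filter_insert, filter_singleton, hua.symm, nav, nab, nac]
  have hRb : #(G.nbrIn R b) = 1 := by
    simp [hRdef, nbrIn, filter_insert, filter_singleton, hub.symm, nbv, nba, nbc]
  have hRc : #(G.nbrIn R c) = 1 := by
    simp [hRdef, nbrIn, filter_insert, filter_singleton, hvc.symm, ncu, nca, ncb]
  have hdeg : ∀ w ∈ U \ R, #(G.nbrIn R w) ≤ 2 := by
    intro w hw
    obtain ⟨hwU, hwR⟩ := mem_sdiff.1 hw
    simp only [hRdef, mem_insert, mem_singleton, not_or] at hwR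
    obtain ⟨hwu, hwv, hwa, hwb, hwc⟩ := hwR
    have nwu : ¬ G.Adj w u := fun h => by
      have := (hmemu w).1 ⟨hwU, h.symm⟩
      tauto
    have nwab : G.Adj w a → ¬ G.Adj w b := fun h h' =>
      hU.no_four_cycle htri hwU ha hu hb h hua.symm hub h'.symm hwu hab
    by_cases hv' : G.Adj w v
    · have nwa : ¬ G.Adj w a := fun h =>
        hU.no_four_cycle htri hwU ha hu hv h hua.symm huv hv'.symm hwu hva.symm
      have nwb : ¬ G.Adj w b := fun h =>
        hU.no_four_cycle htri hwU hb hu hv h hub.symm huv hv'.symm hwu hvb.symm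
      have nwc : ¬ G.Adj w c := fun h => htri w v c hv' h hvc
      simp [hRdef, nbrIn, filter_insert, filter_singleton, nwu, nwa, nwb, nwc, hv']
    · by_cases ha' : G.Adj w a
      · have nwb := nwab ha'
        simp only [hRdef, nbrIn, filter_insert, filter_singleton, nwu, nwb, ha', hv', if_false,
          if_true]
        split_ifs
        · exact card_le_two
        · simp
      · simp only [hRdef, nbrIn, filter_insert, filter_singleton, nwu, ha', hv', if_false]
        split_ifs <;> simp [card_le_two]
  have hne : u ∉ ({v, a, b, c} : Finset V) ∧ v ∉ ({a, b, c} : Finset V) ∧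
      a ∉ ({b, c} : Finset V) ∧ b ∉ ({c} : Finset V) := by
    simp [huv.ne, hua.ne, hub.ne, hcu.symm, hva, hvb, hvc.ne, hab, hac, hbc]
  obtain ⟨n1, n2, n3, n4⟩ := hne
  have key := hU.card_add_mul_lt (R := R) (T := {u, v}) hR (by simp [hRdef])
    (by simp [hRdef, insert_subset_iff])
    (fun S hS h => isAcyclicSet_pair_union hS h
      (by rw [card_nbrIn_sdiff hR, hRv, h3 v hv]) (by
      rw [nbrIn, filter_insert, if_pos huv]
      refine (card_insert_le _ _).trans ?_
      have := card_nbrIn_sdiff (G := G) hR u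
      rw [hRu, h3 u hu] at this
      exact (Nat.add_le_add_right this.le 1)))
    (3 / 20) (fun w hw => by
      rw [h3 w (mem_sdiff.1 hw).1]
      exact mul_le_forestWeight_three (hdeg w hw))
  have hs : ∑ x ∈ R, (#(G.nbrIn U x) - #(G.nbrIn R x)) = 7 := by
    rw [sum_congr rfl fun x hx => by rw [h3 x (hR hx)]]
    conv_lhs => rw [hRdef]
    rw [sum_insert n1, sum_insert n2, sum_insert n3, sum_insert n4, sum_singleton,
      hRu, hRv, hRa, hRb, hRc]
    norm_num
  have hf : ∑ x ∈ R, forestWeight #(G.nbrIn U x) = 3 := by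
    rw [sum_congr rfl fun x hx => by rw [h3 x (hR hx)], sum_const, hRdef,
      card_insert_of_notMem n1, card_insert_of_notMem n2, card_insert_of_notMem n3,
      card_insert_of_notMem n4, card_singleton]
    norm_num [forestWeight]
  rw [hs, hf, card_pair huv.ne] at key
  norm_num at key

end IsMinimalViolation

theorem forestBound_of_cliqueFree [DecidableEq V] (hG : G.CliqueFree 3) (U : Finset V) :
    G.ForestBound U := by
  have htri : ∀ a b c, G.Adj a b → G.Adj a c → ¬ G.Adj b c := fun a b c hab hac hbc =>
    hG {a, b, c} (is3Clique_triple_iff.2 ⟨hab, hac, hbc⟩)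
  induction U using Finset.strongInduction with
  | H U ih =>
    by_contra h
    exact IsMinimalViolation.false ⟨h, ih⟩ htri

end SimpleGraph

theorem theorem1p7 {V : Type*} [Fintype V] (G : SimpleGraph V) [DecidableRel G.Adj]
    (hG : G.CliqueFree 3) :
    ∑ v : V, min (1 : ℝ) (3 / ((G.degree v : ℝ) + 2)) ≤ (G.acyclicNumber : ℝ) := by
  classical
  obtain ⟨S, -, hS, hle⟩ := SimpleGraph.forestBound_of_cliqueFree hG Finset.univ
  have hdeg : ∀ v, (G.nbrIn Finset.univ v).card = G.degree v := fun v => by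
    rw [← G.card_neighborFinset_eq_degree]
    congr 1
    ext w
    simp [SimpleGraph.mem_nbrIn]
  simp only [hdeg] at hle
  refine hle.trans ?_
  unfold SimpleGraph.acyclicNumber
  exact_mod_cast Finset.le_sup (f := Finset.card) (Finset.mem_filter.2 ⟨Finset.mem_univ S, hS⟩)
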